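/- Fix the following terminology. A signature $\sigma=\sigma_{\mathcal B}\sqcup\sigma_{\mathcal D}$ is a finite set of relation symbols with arities, split into base relations ($\sigma_{\mathcal B}$) and binary distinguished relations ($\sigma_{\mathcal D}$). A fact over $\sigma$ is $R(a_1,\dots,a_m)$ with $R\in\sigma$ of arity $m$ and $a_1,\dots,a_m$ domain elements. A conjunctive query (CQ) is an existentially closed conjunction of atoms (without constants); it is base-covered if for each of its $\sigma_{\mathcal D}$-atoms some $\sigma_{\mathcal B}$-atom of the query contains all variables of that atom. A tuple-generating dependency (TGD) is a sentence $\forall\vec x\,(\bigwedge_i\gamma_i(\vec x)\to\exists\vec y\,\bigwedge_j\rho_j(\vec x,\vec y))$ with $\gamma_i,\rho_j$ atoms. It is an inclusion dependency if body and head are single atoms and no variable occurs twice in the same atom. It is a base frontier-guarded TGD (BaseFGTGD) if all variables occurring in both body and head are contained in one base atom of the body, or if there is at most one such variable. For a finite set of facts $\mathcal F_0$, a finite set of constraints $\Sigma$ and a query $Q$, write $\mathrm{QA}_{\mathrm{lin}}(\mathcal F_0,\Sigma,Q)$ for the problem of deciding whether $Q$ holds in every (possibly infinite) set of facts $\mathcal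 F\supseteq\mathcal F_0$ that satisfies $\Sigma$ and in which every distinguished relation is a strict linear order on the elements occurring in $\mathcal F$. Then the following hold. 1. There are a signature $\sigma=\sigma_{\mathcal B}\sqcup\sigma_{\mathcal D}$ where $\sigma_{\mathcal D}$ consists of a single relation (interpreted as a strict linear order), a finite set $\Sigma$ of inclusion dependencies on $\sigma_{\mathcal B}$ (not mentioning the linear order), and a CQ $Q$ on $\sigma$ that is not base-covered, such that the following problem is undecidable: given a finite set of facts $\mathcal F_0$ over $\sigma$, decide $\mathrm{QA}_{\mathrm{lin}}(\mathcal F_0,\Sigma,Q)$. 2. There are a signature $\sigma=\sigma_{\mathcal B}\sqcup\sigma_{\mathcal D}$ where $\sigma_{\mathcal D}$ consists of a single relation (interpreted as a strict linear order) and a finite set $\Sigma'$ of BaseFGTGDs on $\sigma$ such that, for the trivial query $\bot$ (the query that is always false), the following problem is undecidable: given a finite set of facts $\mathcal F_0$ over $\sigma$, decide $\mathrm{QA}_{\mathrm{lin}}(\mathcal F_0,\Sigma',\bot)$, i.e. whether no set of facts $\mathcal F\supseteq\mathcal F_0$ satisfies $\Sigma'$ with the distinguished relation a strict linear order on the elements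 of $\mathcal F$. -/

import Mathlib

namespace QALin

/-- A finite relational signature, split into a base signature (finitely many relations, each with
its arity) and a distinguished signature (finitely many binary relations). -/
structure Signature where
  numBase : ℕ
  baseArity : Fin numBase → ℕ
  numDist : ℕ

/-- The relations of the signature: base relations on the left, distinguished ones on the right. -/
abbrev Signature.Rel (σ : Signature) : Type := Fin σ.numBase ⊕ Fin σ.numDist

def Signature.arity (σ : Signature) : σ.Rel → ℕ
  | Sum.inl r => σ.baseArity r
  | Sum.inr _ => 2

/-- A fact `R(a₁, …, aₘ)` over `D`: a relation with a list of elements of the right length. -/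
abbrev Fact (σ : Signature) (D : Type) : Type :=
  {p : σ.Rel × List D // p.2.length = σ.arity p.1}

theorem primrecPred_isFact (σ : Signature) :
    PrimrecPred fun p : σ.Rel × List ℕ => p.2.length = σ.arity p.1 :=
  Primrec.eq.comp (Primrec.list_length.comp Primrec.snd)
    ((Primrec.dom_finite σ.arity).comp Primrec.fst)

/-- Facts over `ℕ` as inputs of algorithms. -/
instance (σ : Signature) : Primcodable (Fact σ ℕ) :=
  Primcodable.subtype (primrecPred_isFact σ)

namespace Fact

variable {σ : Signature} {D E : Type}

def args (f : Fact σ D) : List D := f.1.2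

/-- The fact (or atom) is over a base relation. -/
def IsBase (f : Fact σ D) : Prop := f.1.1.isLeft = true

/-- Applying a map to all arguments of a fact (or atom). -/
def map (h : D → E) (f : Fact σ D) : Fact σ E :=
  ⟨(f.1.1, f.1.2.map h), by simpa using f.2⟩

end Fact

/-- The fact `a <ᵢ b` for the `i`-th distinguished relation. -/
def distFact {σ : Signature} {D : Type} (i : Fin σ.numDist) (a b : D) : Fact σ D :=
  ⟨(Sum.inr i, [a, b]), rfl⟩

/-- The elements mentioned in a set of facts. -/
def elems {σ : Signature} {D : Type} (F : Set (Fact σ D)) : Set D :=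
  {a | ∃ f ∈ F, a ∈ f.args}

/-- The `i`-th distinguished relation is a strict linear order on the elements of `F`. -/
def IsLinear {σ : Signature} {D : Type} (F : Set (Fact σ D)) (i : Fin σ.numDist) : Prop :=
  (∀ a ∈ elems F, distFact i a a ∉ F) ∧
  (∀ a ∈ elems F, ∀ b ∈ elems F, ∀ c ∈ elems F,
    distFact i a b ∈ F → distFact i b c ∈ F → distFact i a c ∈ F) ∧
  (∀ a ∈ elems F, ∀ b ∈ elems F, a ≠ b → distFact i a b ∈ F ∨ distFact i b a ∈ F)

/-- An atom is a relation applied to variables; the variables are the natural numbers. There are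
no constants. -/
abbrev Atom (σ : Signature) : Type := Fact σ ℕ

/-- The variables occurring in a conjunction of atoms. -/
def varsOf {σ : Signature} (L : List (Atom σ)) : Set ℕ := {x | ∃ A ∈ L, x ∈ A.args}

/-- All atoms of the conjunction hold in `F` under the assignment `h`. -/
def Holds {σ : Signature} {D : Type} (F : Set (Fact σ D)) (h : ℕ → D) (L : List (Atom σ)) : Prop :=
  ∀ A ∈ L, A.map h ∈ F

/-- A Boolean conjunctive query: the existential closure of the conjunction of the atoms. -/
structure CQ (σ : Signature) where
  atoms : List (Atom σ)

def CQ.Sat {σ : Signature} {D : Type} (Q : CQ σ) (F : Set (Fact σ D)) : Prop :=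
  ∃ h : ℕ → D, Holds F h Q.atoms

/-- Every distinguished atom has its variables contained in some base atom of the query. -/
def CQ.BaseCovered {σ : Signature} (Q : CQ σ) : Prop :=
  ∀ A ∈ Q.atoms, ¬ A.IsBase → ∃ B ∈ Q.atoms, B.IsBase ∧ ∀ x ∈ A.args, x ∈ B.args

/-- A union of conjunctive queries: the disjunction of its members. -/
structure UCQ (σ : Signature) where
  disjuncts : List (CQ σ)

def UCQ.Sat {σ : Signature} {D : Type} (Q : UCQ σ) (F : Set (Fact σ D)) : Prop :=
  ∃ q ∈ Q.disjuncts, q.Sat F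

/-- A conjunctive query, as a union with one member. -/
def CQ.toUCQ {σ : Signature} (Q : CQ σ) : UCQ σ := ⟨[Q]⟩

/-- The trivial query that is always false (the empty disjunction): it is entailed exactly when
the facts and the constraints together are unsatisfiable. -/
def UCQ.bot (σ : Signature) : UCQ σ := ⟨[]⟩

/-- A tuple-generating dependency `∀ x⃗ (⋀ body → ∃ y⃗ ⋀ head)`. The variables of the body are
universally quantified, the variables that occur only in the head existentially. -/
structure TGD (σ : Signature) where
  body : List (Atom σ)
  head : List (Atom σ)

namespace TGD

variable {σ : Signature}

def Sat {D : Type} (τ : TGD σ) (F : Set (Fact σ D)) : Prop :=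
  ∀ h : ℕ → D, Holds F h τ.body →
    ∃ h' : ℕ → D, (∀ x ∈ varsOf τ.body, h' x = h x) ∧ Holds F h' τ.head

/-- The variables that occur in both the body and the head. -/
def frontier (τ : TGD σ) : Set ℕ := varsOf τ.body ∩ varsOf τ.head

/-- Base frontier-guarded TGDs: some base atom of the body contains all frontier variables, or
an equality atom `x = x` does. -/
def IsBaseFGTGD (τ : TGD σ) : Prop :=
  (∃ A ∈ τ.body, A.IsBase ∧ ∀ x ∈ τ.frontier, x ∈ A.args) ∨ (∃ x : ℕ, τ.frontier ⊆ {x})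

/-- Inclusion dependencies: body and head are single atoms without repeated variables. -/
def IsID (τ : TGD σ) : Prop :=
  ∃ A B : Atom σ, τ.body = [A] ∧ τ.head = [B] ∧ A.args.Nodup ∧ B.args.Nodup

/-- The dependency is over the base signature: no distinguished relation occurs in it. -/
def OnBase (τ : TGD σ) : Prop :=
  (∀ A ∈ τ.body, A.IsBase) ∧ (∀ A ∈ τ.head, A.IsBase)

end TGD

/-- `F₀` and `S` entail `Q` over linear orders: `Q` holds in every (possibly infinite, of any
cardinality) set of facts `F` that contains `F₀`, satisfies the constraints `S`, and in which every
distinguished relation is a strict linear order on the elements of `F`. The finite set `F₀` is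
given as a list of facts whose elements are named by natural numbers; distinct names are distinct
elements, so the names are embedded into the domain of `F`. -/
def EntailsLin {σ : Signature} (F₀ : List (Fact σ ℕ)) (S : List (TGD σ)) (Q : UCQ σ) : Prop :=
  ∀ (D : Type) (e : ℕ ↪ D) (F : Set (Fact σ D)),
    (∀ f ∈ F₀, f.map e ∈ F) → (∀ τ ∈ S, τ.Sat F) → (∀ i : Fin σ.numDist, IsLinear F i) → Q.Sat F

end QALin

namespace QALin

/-! ### Conditional equations that axiomatise evaluation of a code -/

open Turing.ToPartrec (Code)

/-! The halting problem of one fixed code `c` is reduced to entailment. Evaluation is axiomatised by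
finitely many conditional equations between compositions of two unary functions ("fields"), with one
field `run d` per subcode `d` of `c`.

Inclusion dependencies can say that fields are total: every object has a record with a value for
each field, and each value is again an object. Constants being unavailable, every object carries the
tuple of field names along, and the equations themselves are stored as rule facts, so a single query
tests all of them. What inclusion dependencies cannot say is that fields are single-valued or that
equations hold. The linear order supplies this. The query asks for a rule whose guard holds and
whose left side is smaller than its right side. Since the rules are closed under swapping sides and
distinct elements are comparable, failure of the query forces both sides to be equal. The two
equations per field saying that `ident` and `zero` commute with it as they should also yield
single-valuedness (`IsCountermodel.exists_unique_value`).

The facts for `n` assert that `run c` maps `[n]` to an element that `defd` fixes. If `c` halts on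
`[n]`, a model refuting the query computes the true result (`Basis.Rep.run`), on which `defd` is
zero. Distinct names would then denote one element (`IsCountermodel.not_dom`). If `c` diverges, the
partial lists with the strict interpretation `sem` and any well-order satisfy all equations, hence
refute the query (`not_query_sat_std`). Thus `entailsLin_input_iff`, where signature, dependencies
and query depend on `c` only.

For the second claim, the query becomes the body of a dependency with head `x < x`. Its frontier has
at most one variable, and irreflexivity makes it a denial. -/

/-- Names of unary total functions on partial lists. `run c` evaluates the code `c`, and
`loop f` is the part of the evaluation of `Code.fix f` that follows a call of `f`. -/
inductive FieldName : Type
  | ident | zero | head | tail | defd | succ | pred | sign | dec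
  | run (c : Code)
  | loop (f : Code)

noncomputable instance : DecidableEq FieldName := Classical.decEq _

/-- A conditional equation between compositions of fields: if `p₂ (p₁ x)` is the constant selected
by `pos` (one or zero), then `l₂ (l₁ x) = r₂ (r₁ x)`. -/
structure Rule (N : Type) : Type where
  p₁ : N
  p₂ : N
  pos : Bool
  l₁ : N
  l₂ : N
  r₁ : N
  r₂ : N

namespace Rule

def Valid {N X : Type} (ap : N → X → X) (const : Bool → X) (r : Rule N) : Prop :=
  ∀ x, ap r.p₂ (ap r.p₁ x) = const r.pos → ap r.l₂ (ap r.l₁ x) = ap r.r₂ (ap r.r₁ x)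

def swap {N : Type} (r : Rule N) : Rule N := ⟨r.p₁, r.p₂, r.pos, r.r₁, r.r₂, r.l₁, r.l₂⟩

theorem Valid.swap {N X : Type} {ap : N → X → X} {const : Bool → X} {r : Rule N}
    (h : r.Valid ap const) : r.swap.Valid ap const :=
  fun x hx => (h x hx).symm

def fields {N : Type} (r : Rule N) : List N := [r.p₁, r.p₂, r.l₁, r.l₂, r.r₁, r.r₂]

open FieldName

/-- An unconditional equation. -/
abbrev always (l₁ l₂ r₁ r₂ : FieldName) : Rule FieldName := ⟨ident, zero, false, l₁, l₂, r₁, r₂⟩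

/-- An equation for the defined elements. -/
abbrev ifDef (l₁ l₂ r₁ r₂ : FieldName) : Rule FieldName := ⟨ident, defd, false, l₁, l₂, r₁, r₂⟩

/-- An equation for the lists with head zero. -/
abbrev ifZero (l₁ l₂ r₁ r₂ : FieldName) : Rule FieldName := ⟨head, ident, false, l₁, l₂, r₁, r₂⟩

/-- An equation for the lists with positive head. -/
abbrev ifPos (l₁ l₂ r₁ r₂ : FieldName) : Rule FieldName := ⟨head, sign, true, l₁, l₂, r₁, r₂⟩

end Rule

open FieldName Rule

/-- The guard `defd` keeps these equations true at the undefined list: the constant field `zero` is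
not strict, so unguarded equations involving it would fail there. -/
def dataRules : List (Rule FieldName) :=
  [ifDef tail defd ident zero,
   ifDef succ defd ident zero,
   ifDef succ head ident succ,
   ifDef succ tail zero tail,
   ifDef succ pred ident head,
   ifDef succ sign zero succ,
   ifDef dec head head pred,
   ifDef dec tail ident tail,
   ifDef dec defd ident zero]

/-- For `cons` each equation is guarded by definedness of the branch that its right side ignores,
since the whole is undefined as soon as one branch is. The `loop` field splits one pass of `fix` so
that each side composes only two fields. -/
def codeRules : Code → List (Rule FieldName)
  | .zero' =>
    [ifDef (run .zero') head ident zero,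
     ifDef (run .zero') tail ident ident,
     ifDef (run .zero') defd ident zero]
  | .succ => [always (run .succ) ident head succ]
  | .tail => [always (run .tail) ident ident tail]
  | .cons f fs =>
    [⟨run fs, defd, false, run (.cons f fs), head, run f, head⟩,
     ⟨run fs, defd, false, run (.cons f fs), defd, run f, defd⟩,
     ⟨run f, defd, false, run (.cons f fs), tail, run fs, ident⟩] ++ codeRules f ++ codeRules fs
  | .comp f g => [always (run (.comp f g)) ident (run g) (run f)] ++ codeRules f ++ codeRules g
  | .case f g =>
    [ifZero (run (.case f g)) ident tail (run f),
     ifPos (run (.case f g)) ident dec (run g)] ++ codeRules f ++ codeRules g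
  | .fix f =>
    [always (run (.fix f)) ident (run f) (loop f),
     ifZero (loop f) ident ident tail,
     ifPos (loop f) ident tail (run (.fix f))] ++ codeRules f

/-! ### Models of the rules compute the evaluation function -/

/-- The constants and their equations in a model of the rules. -/
structure Basis (X : Type) (ap : FieldName → X → X) where
  zeroC : X
  nilC : X
  ident_ap : ∀ x, ap ident x = x
  zero_ap : ∀ x, ap zero x = zeroC
  head_zero : ap head zeroC = zeroC
  tail_zero : ap tail zeroC = nilC
  defd_zero : ap defd zeroC = zeroC
  head_nil : ap head nilC = zeroC
  tail_nil : ap tail nilC = nilC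

namespace Basis

variable {X : Type} {ap : FieldName → X → X} (B : Basis X ap)

/-- Numbers are identified with one-element lists, so `head` fixes them. -/
def num (n : ℕ) : X := (ap succ)^[n] B.zeroC

def const (b : Bool) : X := B.num b.toNat

theorem num_succ (n : ℕ) : B.num (n + 1) = ap succ (B.num n) :=
  Function.iterate_succ_apply' _ _ _

def RepList : X → List ℕ → Prop
  | x, [] => x = B.nilC
  | x, n :: v => ap head x = B.num n ∧ RepList (ap tail x) v

/-- The element `x` represents the list `v`. -/
def Rep (x : X) (v : List ℕ) : Prop := ap defd x = B.zeroC ∧ B.RepList x v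

variable {B}

theorem ifDef_eq {l₁ l₂ r₁ r₂ : FieldName} (h : (ifDef l₁ l₂ r₁ r₂).Valid ap B.const) {x : X}
    (hx : ap defd x = B.zeroC) : ap l₂ (ap l₁ x) = ap r₂ (ap r₁ x) :=
  h x (by rw [B.ident_ap]; exact hx)

theorem always_eq {l₁ l₂ r₁ r₂ : FieldName} (h : (always l₁ l₂ r₁ r₂).Valid ap B.const) (x : X) :
    ap l₂ (ap l₁ x) = ap r₂ (ap r₁ x) :=
  h x (by rw [B.zero_ap]; rfl)

theorem ifZero_eq {l₁ l₂ r₁ r₂ : FieldName} (h : (ifZero l₁ l₂ r₁ r₂).Valid ap B.const) {x : X}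
    (hx : ap head x = B.num 0) : ap l₂ (ap l₁ x) = ap r₂ (ap r₁ x) :=
  h x (by rw [B.ident_ap]; exact hx)

theorem defd_num (hd : ∀ r ∈ dataRules, r.Valid ap B.const)
    (n : ℕ) : ap defd (B.num n) = B.zeroC := by
  induction n with
  | zero => exact B.defd_zero
  | succ n ih =>
    rw [num_succ, ifDef_eq (hd (ifDef succ defd ident zero) (by simp [dataRules])) ih, B.zero_ap]

theorem head_num (hd : ∀ r ∈ dataRules, r.Valid ap B.const)
    (n : ℕ) : ap head (B.num n) = B.num n := by
  cases n with
  | zero => exact B.head_zero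
  | succ n =>
    rw [num_succ, ifDef_eq (hd (ifDef succ head ident succ) (by simp [dataRules]))
      (defd_num hd n), B.ident_ap]

theorem tail_num (hd : ∀ r ∈ dataRules, r.Valid ap B.const)
    (n : ℕ) : ap tail (B.num n) = B.nilC := by
  cases n with
  | zero => exact B.tail_zero
  | succ n =>
    rw [num_succ, ifDef_eq (hd (ifDef succ tail zero tail) (by simp [dataRules]))
      (defd_num hd n), B.zero_ap, B.tail_zero]

theorem pred_num (hd : ∀ r ∈ dataRules, r.Valid ap B.const)
    (n : ℕ) : ap pred (B.num (n + 1)) = B.num n := by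
  rw [num_succ, ifDef_eq (hd (ifDef succ pred ident head) (by simp [dataRules]))
      (defd_num hd n), B.ident_ap, head_num hd]

theorem sign_num (hd : ∀ r ∈ dataRules, r.Valid ap B.const)
    (n : ℕ) : ap sign (B.num (n + 1)) = B.num 1 := by
  rw [num_succ, ifDef_eq (hd (ifDef succ sign zero succ) (by simp [dataRules]))
      (defd_num hd n), B.zero_ap]
  rfl

theorem ifPos_eq (hd : ∀ r ∈ dataRules, r.Valid ap B.const)
    {l₁ l₂ r₁ r₂ : FieldName} (h : (ifPos l₁ l₂ r₁ r₂).Valid ap B.const) {x : X} {n : ℕ}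
    (hx : ap head x = B.num (n + 1)) : ap l₂ (ap l₁ x) = ap r₂ (ap r₁ x) :=
  h x (by rw [hx]; exact sign_num hd n)

theorem rep_num (hd : ∀ r ∈ dataRules, r.Valid ap B.const) (n : ℕ) : B.Rep (B.num n) [n] :=
  ⟨defd_num hd n, head_num hd n, tail_num hd n⟩

theorem Rep.head {x : X} {v : List ℕ} (h : B.Rep x v) : ap head x = B.num v.headI := by
  cases v with
  -- The default head of the empty list is zero, in the model as in `List.headI`.
  | nil => rw [h.2]; exact B.head_nil
  | cons n v => exact h.2.1

theorem Rep.tail (hd : ∀ r ∈ dataRules, r.Valid ap B.const)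
    {x : X} {v : List ℕ} (h : B.Rep x v) : B.Rep (ap tail x) v.tail := by
  refine ⟨?_, ?_⟩
  · rw [ifDef_eq (hd (ifDef FieldName.tail defd ident zero) (by simp [dataRules])) h.1, B.zero_ap]
  · cases v with
    | nil => rw [h.2]; exact B.tail_nil
    | cons n v => exact h.2.2

theorem Rep.dec (hd : ∀ r ∈ dataRules, r.Valid ap B.const)
    {x : X} {v : List ℕ} {n : ℕ} (h : B.Rep x v) (hn : v.headI = n + 1) :
    B.Rep (ap dec x) (n :: v.tail) := by
  refine ⟨?_, ?_, ?_⟩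
  · rw [ifDef_eq (hd (ifDef FieldName.dec defd ident zero) (by simp [dataRules])) h.1, B.zero_ap]
  · rw [ifDef_eq (hd (ifDef .dec .head .head pred) (by simp [dataRules])) h.1,
      h.head, hn, pred_num hd]
  · rw [ifDef_eq (hd (ifDef .dec .tail ident .tail) (by simp [dataRules])) h.1,
      B.ident_ap]
    exact (h.tail hd).2

/-- Induction on the code. Only terminating evaluations are traced; nothing is claimed about the
model elsewhere. -/
theorem Rep.run (hd : ∀ r ∈ dataRules, r.Valid ap B.const)
    (c : Code) : (∀ r ∈ codeRules c, r.Valid ap B.const) →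
    ∀ v w, w ∈ c.eval v → ∀ x, B.Rep x v → B.Rep (ap (run c) x) w := by
  induction c with
  | zero' =>
    intro hc v w hw x hx
    simp only [codeRules, List.mem_cons, List.not_mem_nil, or_false, forall_eq_or_imp,
      forall_eq] at hc
    obtain ⟨h1, h2, h3⟩ := hc
    simp only [Code.zero'_eval, Part.pure_eq_some, Part.mem_some_iff] at hw
    subst hw
    refine ⟨?_, ?_, ?_⟩
    · rw [ifDef_eq h3 hx.1, B.zero_ap]
    · rw [ifDef_eq h1 hx.1, B.zero_ap]; rfl
    · rw [ifDef_eq h2 hx.1, B.ident_ap, B.ident_ap]; exact hx.2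
  | succ =>
    intro hc v w hw x hx
    simp only [codeRules, List.mem_cons, List.not_mem_nil, or_false, forall_eq] at hc
    simp only [Code.succ_eval, Part.pure_eq_some, Part.mem_some_iff] at hw
    subst hw
    have := always_eq hc x
    rw [B.ident_ap, hx.head, ← B.num_succ] at this
    rw [this]
    exact rep_num hd _
  | tail =>
    intro hc v w hw x hx
    simp only [codeRules, List.mem_cons, List.not_mem_nil, or_false, forall_eq] at hc
    simp only [Code.tail_eval, Part.pure_eq_some, Part.mem_some_iff] at hw
    subst hw
    have := always_eq hc x
    rw [B.ident_ap, B.ident_ap] at this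
    rw [this]
    exact hx.tail hd
  | cons f fs ihf ihfs =>
    intro hc v w hw x hx
    simp only [codeRules, List.cons_append, List.nil_append, List.forall_mem_cons,
      List.forall_mem_append] at hc
    obtain ⟨h1, h2, h3, hf, hfs⟩ := hc
    simp only [Code.cons_eval, Part.pure_eq_some, Part.bind_eq_bind, Part.mem_bind_iff,
      Part.mem_some_iff] at hw
    obtain ⟨a, ha, b, hb, rfl⟩ := hw
    have ra := ihf hf v a ha x hx
    have rb := ihfs hfs v b hb x hx
    refine ⟨?_, ?_, ?_⟩
    · rw [h2 x rb.1]; exact ra.1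
    · rw [h1 x rb.1]; exact ra.head
    · rw [h3 x ra.1, B.ident_ap]; exact rb.2
  | comp f g ihf ihg =>
    intro hc v w hw x hx
    simp only [codeRules, List.cons_append, List.nil_append, List.forall_mem_cons,
      List.forall_mem_append] at hc
    obtain ⟨h1, hf, hg⟩ := hc
    rw [Code.comp_eval] at hw
    obtain ⟨a, ha, hw⟩ := Part.mem_bind_iff.1 hw
    have := always_eq h1 x
    rw [B.ident_ap] at this
    rw [this]
    exact ihf hf a w hw _ (ihg hg v a ha x hx)
  | case f g ihf ihg =>
    intro hc v w hw x hx
    simp only [codeRules, List.cons_append, List.nil_append, List.forall_mem_cons,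
      List.forall_mem_append] at hc
    obtain ⟨h1, h2, hf, hg⟩ := hc
    simp only [Code.case_eval] at hw
    cases hn : v.headI with
    | zero =>
      rw [hn] at hw
      have := ifZero_eq h1 (x := x) (by rw [hx.head, hn])
      rw [B.ident_ap] at this
      rw [this]
      exact ihf hf _ w hw _ (hx.tail hd)
    | succ n =>
      rw [hn] at hw
      have := ifPos_eq hd h2 (x := x) (n := n) (by rw [hx.head, hn])
      rw [B.ident_ap] at this
      rw [this]
      exact ihg hg _ w hw _ (hx.dec hd hn)
  | fix f ihf =>
    intro hc v w hw
    simp only [codeRules, List.cons_append, List.nil_append, List.mem_cons,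
      forall_eq_or_imp] at hc
    obtain ⟨h1, h2, h3, hf⟩ := hc
    have h1' := always_eq h1
    simp only [B.ident_ap] at h1'
    rw [Code.fix_eval] at hw
    -- Induction along the finitely many passes of the terminating loop: last pass first, then one
    -- further pass in front.
    refine PFun.fixInduction' (C := fun v => ∀ x, B.Rep x v → B.Rep (ap (FieldName.run (.fix f)) x) w)
      hw ?_ ?_
    · intro v hv x hx
      rw [Part.mem_map_iff] at hv
      obtain ⟨u, hu, huw⟩ := hv
      have ru := ihf hf v u hu x hx
      split_ifs at huw with hz
      cases huw
      have := ifZero_eq h2 (x := ap (FieldName.run f) x) (by rw [ru.head, hz])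
      rw [B.ident_ap, B.ident_ap] at this
      rw [h1', this]
      exact ru.tail hd
    · intro v v' _ hv ih x hx
      rw [Part.mem_map_iff] at hv
      obtain ⟨u, hu, huw⟩ := hv
      have ru := ihf hf v u hu x hx
      split_ifs at huw with hz
      cases huw
      obtain ⟨n, hn⟩ := Nat.exists_eq_succ_of_ne_zero hz
      have := ifPos_eq hd h3 (x := ap (FieldName.run f) x) (n := n) (by rw [ru.head, hn])
      rw [B.ident_ap] at this
      rw [h1', this]
      exact ih _ (ru.tail hd)

end Basis

/-! ### The standard model -/

/-- The evaluation of a code, as a function with values in `Part (List ℕ)`. -/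
def evalPart (c : Code) (v : List ℕ) : Part (List ℕ) := c.eval v

theorem evalPart_cons (f fs : Code) (v : List ℕ) : evalPart (.cons f fs) v =
    (evalPart f v).bind fun a => (evalPart fs v).bind fun b => Part.some (a.headI :: b) := by
  rw [evalPart, Code.cons_eval]; rfl

theorem evalPart_comp (f g : Code) (v : List ℕ) :
    evalPart (.comp f g) v = (evalPart g v).bind (evalPart f) := by
  rw [evalPart, Code.comp_eval]; rfl

theorem evalPart_case_zero (f g : Code) {v : List ℕ} (h : v.headI = 0) :
    evalPart (.case f g) v = evalPart f v.tail := by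
  rw [evalPart, Code.case_eval]; simp only [h]; rfl

theorem evalPart_case_succ (f g : Code) {v : List ℕ} {n : ℕ} (h : v.headI = n + 1) :
    evalPart (.case f g) v = evalPart g (n :: v.tail) := by
  rw [evalPart, Code.case_eval]; simp only [h]; rfl

/-- One unfolding of the loop, as an equality of partial values: divergence must match too, because
the standard model has to satisfy the `loop` equations everywhere. -/
theorem evalPart_fix (f : Code) (v : List ℕ) : evalPart (.fix f) v =
    (evalPart f v).bind fun w =>
      if w.headI = 0 then Part.some w.tail else evalPart (.fix f) w.tail := by
  have key (v w : List ℕ) : w ∈ evalPart (.fix f) v ↔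
      (Sum.inl w ∈ (evalPart f v).map fun v : List ℕ =>
        if v.headI = 0 then Sum.inl v.tail else Sum.inr v.tail) ∨
      ∃ a, (Sum.inr a ∈ (evalPart f v).map fun v : List ℕ =>
        if v.headI = 0 then Sum.inl v.tail else Sum.inr v.tail) ∧ w ∈ evalPart (.fix f) a := by
    rw [evalPart, Code.fix_eval]
    exact PFun.mem_fix_iff
  ext w
  rw [key]
  simp only [Part.mem_map_iff, Part.mem_bind_iff]
  constructor
  · rintro (⟨u, hu, h⟩ | ⟨a, ⟨u, hu, h⟩, hw⟩)
    · refine ⟨u, hu, ?_⟩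
      split_ifs at h ⊢ with hz
      simpa using h.symm
    · refine ⟨u, hu, ?_⟩
      split_ifs at h ⊢ with hz
      cases h
      exact hw
  · rintro ⟨u, hu, h⟩
    split_ifs at h with hz
    · exact Or.inl ⟨u, hu, by rw [if_pos hz, Part.mem_some_iff.1 h]⟩
    · exact Or.inr ⟨u.tail, ⟨u, hu, by simp [hz]⟩, h⟩

/-- The strict interpretation of the fields on partial lists. -/
noncomputable def sem : FieldName → Part (List ℕ) → Part (List ℕ)
  | ident, x => x
  | zero, _ => Part.some [0]
  | head, x => x.bind fun v => Part.some [v.headI]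
  | tail, x => x.bind fun v => Part.some v.tail
  | defd, x => x.bind fun _ => Part.some [0]
  | succ, x => x.bind fun v => Part.some [v.headI + 1]
  | pred, x => x.bind fun v => Part.some [v.headI - 1]
  | sign, x => x.bind fun v => Part.some [if v.headI = 0 then 0 else 1]
  | dec, x => x.bind fun v => Part.some ((v.headI - 1) :: v.tail)
  | run c, x => x.bind (evalPart c)
  | loop f, x => x.bind fun v =>
      if v.headI = 0 then Part.some v.tail else evalPart (.fix f) v.tail

def semConst (b : Bool) : Part (List ℕ) := Part.some [b.toNat]

/-- At the undefined list either both sides agree or the guard is undefined, hence not a constant;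
only genuine lists remain. -/
theorem valid_sem_of_some {r : Rule FieldName}
    (h₀ : sem r.l₂ (sem r.l₁ Part.none) = sem r.r₂ (sem r.r₁ Part.none) ∨
      sem r.p₂ (sem r.p₁ Part.none) = Part.none)
    (h : ∀ v, sem r.p₂ (sem r.p₁ (Part.some v)) = semConst r.pos →
      sem r.l₂ (sem r.l₁ (Part.some v)) = sem r.r₂ (sem r.r₁ (Part.some v))) :
    r.Valid sem semConst := by
  intro x hx
  obtain rfl | ⟨v, rfl⟩ := Part.eq_none_or_eq_some x
  · rcases h₀ with h₀ | h₀
    · exact h₀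
    · rw [h₀] at hx
      exact absurd hx.symm (Part.some_ne_none _)
  · exact h v hx

theorem valid_dataRules : ∀ r ∈ dataRules, r.Valid sem semConst := by
  simp only [dataRules, List.forall_mem_cons, List.not_mem_nil, false_imp_iff, implies_true,
    and_true]
  refine ⟨?_, ?_, ?_, ?_, ?_, ?_, ?_, ?_, ?_⟩ <;>
    exact valid_sem_of_some (by simp [sem]) (by simp [sem])

theorem valid_ifZero {l₁ l₂ r₁ r₂ : FieldName}
    (h₀ : sem l₂ (sem l₁ Part.none) = sem r₂ (sem r₁ Part.none))
    (h : ∀ v : List ℕ, v.headI = 0 →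
      sem l₂ (sem l₁ (Part.some v)) = sem r₂ (sem r₁ (Part.some v))) :
    (ifZero l₁ l₂ r₁ r₂).Valid sem semConst :=
  valid_sem_of_some (Or.inl h₀) fun v hv => h v (by simpa [sem, semConst] using hv)

theorem valid_ifPos {l₁ l₂ r₁ r₂ : FieldName}
    (h₀ : sem l₂ (sem l₁ Part.none) = sem r₂ (sem r₁ Part.none))
    (h : ∀ (v : List ℕ) (n : ℕ), v.headI = n + 1 →
      sem l₂ (sem l₁ (Part.some v)) = sem r₂ (sem r₁ (Part.some v))) :
    (ifPos l₁ l₂ r₁ r₂).Valid sem semConst := by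
  refine valid_sem_of_some (Or.inl h₀) fun v hv => ?_
  obtain ⟨n, hn⟩ : ∃ n, v.headI = n + 1 := Nat.exists_eq_succ_of_ne_zero fun h => by
    simp [sem, semConst, h] at hv
  exact h v n hn

theorem valid_ifSomeRun {c : Code} {l₁ l₂ r₁ r₂ : FieldName}
    (h : ∀ v w : List ℕ, evalPart c v = Part.some w →
      sem l₂ (sem l₁ (Part.some v)) = sem r₂ (sem r₁ (Part.some v))) :
    (⟨run c, defd, false, l₁, l₂, r₁, r₂⟩ : Rule FieldName).Valid sem semConst := by
  refine valid_sem_of_some (Or.inr (by simp [sem])) fun v hv => ?_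
  obtain hn | ⟨w, hw⟩ := Part.eq_none_or_eq_some (evalPart c v)
  · simp only [sem, semConst, Part.bind_some, hn, Part.bind_none] at hv
    exact absurd hv.symm (Part.some_ne_none _)
  · exact h v w hw

theorem valid_codeRules (c : Code) : ∀ r ∈ codeRules c, r.Valid sem semConst := by
  induction c with
  | zero' =>
    simp only [codeRules, List.forall_mem_cons, List.not_mem_nil, false_imp_iff, implies_true,
      and_true]
    refine ⟨?_, ?_, ?_⟩ <;>
      exact valid_sem_of_some (by simp [sem]) (by simp [sem, evalPart, Code.eval])
  | succ =>
    simp only [codeRules, List.forall_mem_cons, List.not_mem_nil, false_imp_iff, implies_true,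
      and_true]
    exact valid_sem_of_some (by simp [sem]) (by simp [sem, evalPart, Code.eval])
  | tail =>
    simp only [codeRules, List.forall_mem_cons, List.not_mem_nil, false_imp_iff, implies_true,
      and_true]
    exact valid_sem_of_some (by simp [sem]) (by simp [sem, evalPart, Code.eval])
  | cons f fs ihf ihfs =>
    simp only [codeRules, List.cons_append, List.nil_append, List.forall_mem_cons,
      List.forall_mem_append]
    refine ⟨?_, ?_, ?_, ihf, ihfs⟩
    · refine valid_ifSomeRun fun v w hw => ?_
      obtain h | ⟨u, h⟩ := Part.eq_none_or_eq_some (evalPart f v) <;>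
        simp [sem, evalPart_cons, hw, h]
    · refine valid_ifSomeRun fun v w hw => ?_
      obtain h | ⟨u, h⟩ := Part.eq_none_or_eq_some (evalPart f v) <;>
        simp [sem, evalPart_cons, hw, h]
    · refine valid_ifSomeRun fun v w hw => ?_
      obtain h | ⟨u, h⟩ := Part.eq_none_or_eq_some (evalPart fs v) <;>
        simp [sem, evalPart_cons, hw, h]
  | comp f g ihf ihg =>
    simp only [codeRules, List.cons_append, List.nil_append, List.forall_mem_cons,
      List.forall_mem_append]
    exact ⟨valid_sem_of_some (by simp [sem]) (by simp [sem, evalPart_comp]), ihf, ihg⟩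
  | case f g ihf ihg =>
    simp only [codeRules, List.cons_append, List.nil_append, List.forall_mem_cons,
      List.forall_mem_append]
    refine ⟨valid_ifZero (by simp [sem]) fun v hv => ?_,
      valid_ifPos (by simp [sem]) fun v n hn => ?_, ihf, ihg⟩
    · simp [sem, evalPart_case_zero f g hv]
    · simp [sem, evalPart_case_succ f g hn, hn]
  | fix f ihf =>
    simp only [codeRules, List.cons_append, List.nil_append, List.forall_mem_cons]
    refine ⟨valid_sem_of_some (by simp [sem]) fun v _ => ?_,
      valid_ifZero (by simp [sem]) fun v hv => ?_,
      valid_ifPos (by simp [sem]) fun v n hn => ?_, ihf⟩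
    · simpa [sem] using evalPart_fix f v
    · simp [sem, hv]
    · simp [sem, hn]

/-! ### The signature, the constraints and the query -/

/-- Relations for objects with the names of the `k` fields, for records (an object, the values of
its fields, the names of the fields), for single field values (name, object, value), and for
rules. -/
def sig (k : ℕ) : Signature := ⟨4, ![k + 1, 2 * k + 1, 3, 7], 1⟩

/-! ### Facts over the signature -/

section Facts

variable {k : ℕ} {D E : Type}

def objFact (x : D) (n : Fin k → D) : Fact (sig k) D :=
  ⟨(Sum.inl (0 : Fin 4), x :: List.ofFn n), by simp [Signature.arity, sig]⟩

def recFact (x : D) (y n : Fin k → D) : Fact (sig k) D :=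
  ⟨(Sum.inl (1 : Fin 4), x :: (List.ofFn y ++ List.ofFn n)), by
    simp [Signature.arity, sig]; omega⟩

def appFact (f x y : D) : Fact (sig k) D := ⟨(Sum.inl (2 : Fin 4), [f, x, y]), rfl⟩

def ruleFact (p₁ p₂ v l₁ l₂ r₁ r₂ : D) : Fact (sig k) D :=
  ⟨(Sum.inl (3 : Fin 4), [p₁, p₂, v, l₁, l₂, r₁, r₂]), rfl⟩

def ltFact (x y : D) : Fact (sig k) D := distFact (0 : Fin 1) x y

@[simp]
theorem objFact_isBase (x : D) (n : Fin k → D) : (objFact x n).IsBase := rfl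

@[simp]
theorem recFact_isBase (x : D) (y n : Fin k → D) : (recFact x y n).IsBase := rfl

@[simp]
theorem appFact_isBase (f x y : D) : (appFact f x y : Fact (sig k) D).IsBase := rfl

theorem ltFact_not_isBase (x y : D) : ¬ (ltFact x y : Fact (sig k) D).IsBase := Bool.false_ne_true

@[simp]
theorem objFact_map (h : D → E) (x : D) (n : Fin k → D) :
    (objFact x n).map h = objFact (h x) (h ∘ n) := by
  simp [objFact, Fact.map, List.map_ofFn]

@[simp]
theorem recFact_map (h : D → E) (x : D) (y n : Fin k → D) :
    (recFact x y n).map h = recFact (h x) (h ∘ y) (h ∘ n) := by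
  simp [recFact, Fact.map, List.map_ofFn]

@[simp]
theorem appFact_map (h : D → E) (f x y : D) :
    (appFact f x y : Fact (sig k) D).map h = appFact (h f) (h x) (h y) := rfl

@[simp]
theorem ruleFact_map (h : D → E) (p₁ p₂ v l₁ l₂ r₁ r₂ : D) :
    (ruleFact p₁ p₂ v l₁ l₂ r₁ r₂ : Fact (sig k) D).map h =
      ruleFact (h p₁) (h p₂) (h v) (h l₁) (h l₂) (h r₁) (h r₂) := rfl

@[simp]
theorem ltFact_map (h : D → E) (x y : D) :
    (ltFact x y : Fact (sig k) D).map h = ltFact (h x) (h y) := rfl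

end Facts

/-! ### The inclusion dependencies and the query -/

section Constraints

variable (k : ℕ)

/-- The variables for the values of the fields. -/
def valVar (i : Fin k) : ℕ := 1 + i

/-- The variables for the names of the fields. -/
def nameVar (i : Fin k) : ℕ := 1 + k + i

/-- An inclusion dependency has a single head atom, so all values are invented in one wide record;
the other dependencies project it and invent nothing. -/
def recTGD : TGD (sig k) := ⟨[objFact 0 (nameVar k)], [recFact 0 (valVar k) (nameVar k)]⟩

def objTGD (i : Fin k) : TGD (sig k) :=
  ⟨[recFact 0 (valVar k) (nameVar k)], [objFact (valVar k i) (nameVar k)]⟩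

def appTGD (i : Fin k) : TGD (sig k) :=
  ⟨[recFact 0 (valVar k) (nameVar k)], [appFact (nameVar k i) 0 (valVar k i)]⟩

def constraints : List (TGD (sig k)) :=
  recTGD k :: (List.finRange k).flatMap fun i => [objTGD k i, appTGD k i]

theorem objTGD_mem (i : Fin k) : objTGD k i ∈ constraints k :=
  List.mem_cons_of_mem _ (List.mem_flatMap.2 ⟨i, List.mem_finRange i, by simp⟩)

theorem appTGD_mem (i : Fin k) : appTGD k i ∈ constraints k :=
  List.mem_cons_of_mem _ (List.mem_flatMap.2 ⟨i, List.mem_finRange i, by simp⟩)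

/-- The query: some rule is violated, its left side being less than its right side. -/
def query : CQ (sig k) :=
  ⟨[ruleFact 0 1 2 3 4 5 6, appFact 0 7 8, appFact 1 8 2, appFact 3 7 9, appFact 4 9 10,
    appFact 5 7 11, appFact 6 11 12, ltFact 10 12]⟩

theorem valVar_injective : Function.Injective (valVar k) := fun i j h => by
  simp only [valVar] at h; omega

theorem nameVar_injective : Function.Injective (nameVar k) := fun i j h => by
  simp only [nameVar] at h; omega

theorem nodup_objAtom (x : ℕ) (hx : x < 1 + k) :
    (objFact x (nameVar k) : Atom (sig k)).args.Nodup := by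
  simp only [Fact.args, objFact, List.nodup_cons, List.mem_ofFn, List.nodup_ofFn]
  refine ⟨?_, nameVar_injective k⟩
  rintro ⟨i, hi⟩
  simp only [nameVar] at hi
  omega

theorem nodup_recAtom : (recFact 0 (valVar k) (nameVar k) : Atom (sig k)).args.Nodup := by
  simp only [Fact.args, recFact, List.nodup_cons, List.mem_append, List.mem_ofFn,
    List.nodup_append, List.nodup_ofFn]
  refine ⟨?_, valVar_injective k, nameVar_injective k, ?_⟩
  · rintro (⟨i, hi⟩ | ⟨i, hi⟩)
    · simp only [valVar] at hi; omega
    · simp only [nameVar] at hi; omega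
  · rintro _ ⟨i, rfl⟩ _ ⟨j, rfl⟩
    simp only [valVar, nameVar]; omega

theorem constraints_spec : ∀ τ ∈ constraints k, τ.IsID ∧ τ.OnBase := by
  intro τ hτ
  simp only [constraints, List.mem_cons, List.mem_flatMap, List.mem_finRange, true_and,
    List.not_mem_nil, or_false] at hτ
  rcases hτ with rfl | ⟨i, rfl | rfl⟩
  · exact ⟨⟨_, _, rfl, rfl, nodup_objAtom k 0 (by omega), nodup_recAtom k⟩,
      by simp [recTGD, TGD.OnBase]⟩
  · exact ⟨⟨_, _, rfl, rfl, nodup_recAtom k, nodup_objAtom k _ (by simp only [valVar]; omega)⟩,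
      by simp [objTGD, TGD.OnBase]⟩
  · refine ⟨⟨_, _, rfl, rfl, nodup_recAtom k, ?_⟩,
      by simp [appTGD, TGD.OnBase]⟩
    have h₁ : nameVar k i ≠ 0 := by simp only [nameVar]; omega
    have h₂ : nameVar k i ≠ valVar k i := by simp only [nameVar, valVar]; omega
    have h₃ : 0 ≠ valVar k i := by simp only [valVar]; omega
    simp [Fact.args, appFact, h₁, h₂, h₃]

/-- The variables 10 and 12 for the two sides of the rule share no base atom. -/
theorem query_not_baseCovered : ¬ (query k).BaseCovered := by
  intro h
  obtain ⟨B, hB, hb, hx⟩ := h (ltFact 10 12) (by simp [query])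
    (ltFact_not_isBase _ _)
  have h1 := hx 10 (by simp [Fact.args, ltFact, distFact])
  have h2 := hx 12 (by simp [Fact.args, ltFact, distFact])
  simp only [query, List.mem_cons, List.not_mem_nil, or_false] at hB
  rcases hB with rfl | rfl | rfl | rfl | rfl | rfl | rfl | rfl
  all_goals first
    | exact ltFact_not_isBase _ _ hb
    | simp [Fact.args, appFact, ruleFact] at h1 h2

end Constraints

/-! ### What dependencies and order yield in a model -/

section Consequences

variable {k : ℕ} {D : Type} {F : Set (Fact (sig k) D)}

/-- The assignment of an object, the values of its fields and their names to the variables. -/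
def assign (x : D) (y n : Fin k → D) (j : ℕ) : D :=
  if h : j - 1 < k ∧ 0 < j then y ⟨j - 1, h.1⟩
  else if h : j - 1 - k < k ∧ 0 < j then n ⟨j - 1 - k, h.1⟩ else x

theorem assign_zero (x : D) (y n : Fin k → D) : assign x y n 0 = x := by simp [assign]

theorem assign_val (x : D) (y n : Fin k → D) : assign x y n ∘ valVar k = y := by
  funext i
  simp [assign, valVar]

theorem assign_name (x : D) (y n : Fin k → D) : assign x y n ∘ nameVar k = n := by
  funext i
  have h₁ : ¬ (1 + k + (i : ℕ) - 1 < k ∧ 0 < 1 + k + (i : ℕ)) := by omega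
  have h₂ : 1 + k + (i : ℕ) - 1 - k < k ∧ 0 < 1 + k + (i : ℕ) := by omega
  rw [Function.comp_apply, assign, nameVar, dif_neg h₁, dif_pos h₂]
  congr 1
  apply Fin.ext
  simp only
  omega

theorem exists_values (hF : ∀ τ ∈ constraints k, τ.Sat F) {x : D} {n : Fin k → D}
    (hx : objFact x n ∈ F) :
    ∃ y : Fin k → D, ∀ i, objFact (y i) n ∈ F ∧ appFact (n i) x (y i) ∈ F := by
  -- The second argument of `assign` is a dummy: the body has no value variables.
  obtain ⟨h, hh, hr⟩ := hF (recTGD k) (by simp [constraints]) (assign x n n)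
    (by simpa [recTGD, Holds, assign_zero, assign_name] using hx)
  have h0 : h 0 = x := by
    rw [hh 0 (by simp [varsOf, recTGD, Fact.args, objFact]), assign_zero]
  have hn : h ∘ nameVar k = n := by
    rw [← assign_name x n n]
    funext i
    exact hh _ (by simp [varsOf, recTGD, Fact.args, objFact])
  replace hr : recFact x (h ∘ valVar k) n ∈ F := by simpa [recTGD, Holds, h0, hn] using hr
  refine ⟨h ∘ valVar k, fun i => ⟨?_, ?_⟩⟩
  · obtain ⟨g, hg, ho⟩ := hF (objTGD k i) (objTGD_mem k i) h
      (by simpa [objTGD, Holds, h0, hn] using hr)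
    have e₁ : g (valVar k i) = h (valVar k i) :=
      hg _ (by simp [varsOf, objTGD, Fact.args, recFact])
    have e₂ : g ∘ nameVar k = n := by
      rw [← hn]
      funext i
      exact hg _ (by simp [varsOf, objTGD, Fact.args, recFact])
    simpa [objTGD, Holds, e₁, e₂] using ho
  · obtain ⟨g, hg, ho⟩ := hF (appTGD k i) (appTGD_mem k i) h
      (by simpa [appTGD, Holds, h0, hn] using hr)
    have e₀ : g 0 = x := by
      rw [← h0]; exact hg _ (by simp [varsOf, appTGD, Fact.args, recFact])
    have e₁ : g (valVar k i) = h (valVar k i) :=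
      hg _ (by simp [varsOf, appTGD, Fact.args, recFact])
    have e₂ : g (nameVar k i) = n i := by
      rw [← hn]; exact hg _ (by simp [varsOf, appTGD, Fact.args, recFact])
    simpa [appTGD, Holds, e₀, e₁, e₂] using ho

theorem query_sat_of_lt {p₁ p₂ v l₁ l₂ r₁ r₂ x u a y b z : D}
    (hr : ruleFact p₁ p₂ v l₁ l₂ r₁ r₂ ∈ F) (h₁ : appFact p₁ x u ∈ F) (h₂ : appFact p₂ u v ∈ F)
    (h₃ : appFact l₁ x a ∈ F) (h₄ : appFact l₂ a y ∈ F) (h₅ : appFact r₁ x b ∈ F)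
    (h₆ : appFact r₂ b z ∈ F) (hlt : ltFact y z ∈ F) : (query k).Sat F := by
  -- The list position is the number of the variable in `query`.
  refine ⟨fun j => [p₁, p₂, v, l₁, l₂, r₁, r₂, x, u, a, y, b, z].getD j x, ?_⟩
  simp only [Holds, query, List.forall_mem_cons, ruleFact_map, appFact_map, ltFact_map]
  exact ⟨hr, h₁, h₂, h₃, h₄, h₅, h₆, hlt, by simp⟩

theorem lt_or_lt_of_ne (hlin : ∀ i, IsLinear F i) {f₁ x₁ y f₂ x₂ z : D}
    (h₁ : appFact f₁ x₁ y ∈ F) (h₂ : appFact f₂ x₂ z ∈ F) (hne : y ≠ z) :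
    ltFact y z ∈ F ∨ ltFact z y ∈ F :=
  (hlin (0 : Fin 1)).2.2 y ⟨_, h₁, by simp [Fact.args, appFact]⟩ z
    ⟨_, h₂, by simp [Fact.args, appFact]⟩ hne

end Consequences

/-! ### The facts for a code and an input -/

/-- The fields that are named in the facts for `c`. -/
def fieldList (c : Code) : List FieldName :=
  [ident, zero, head, tail, defd, succ, run c] ++ (dataRules ++ codeRules c).flatMap Rule.fields

/-- The rules of `c`, and equations that make `ident` the identity and `zero` constant. -/
def equations (c : Code) : List (Rule FieldName) :=
  dataRules ++ codeRules c ++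
    (fieldList c).flatMap fun f => [always f ident ident f, always f zero ident zero]

def ruleList (c : Code) : List (Rule FieldName) := equations c ++ (equations c).map Rule.swap

theorem mem_fieldList {c : Code} {r : Rule FieldName} (hr : r ∈ ruleList c) {f : FieldName}
    (hf : f ∈ r.fields) : f ∈ fieldList c := by
  have key : ∀ r ∈ equations c, ∀ f ∈ r.fields, f ∈ fieldList c := by
    intro r hr f hf
    rw [equations, List.mem_append, List.mem_flatMap] at hr
    rcases hr with hr | ⟨g, hg, hr⟩
    · exact List.mem_append_right _ (List.mem_flatMap.2 ⟨r, hr, hf⟩)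
    · have hi : ident ∈ fieldList c := by simp [fieldList]
      have hz : zero ∈ fieldList c := by simp [fieldList]
      simp only [List.mem_cons, List.not_mem_nil, or_false] at hr
      rcases hr with rfl | rfl <;>
        simp only [Rule.fields, List.mem_cons, List.not_mem_nil, or_false] at hf <;>
        rcases hf with rfl | rfl | rfl | rfl | rfl | rfl <;> assumption
  rw [ruleList, List.mem_append, List.mem_map] at hr
  rcases hr with hr | ⟨r, hr, rfl⟩
  · exact key r hr f hf
  · refine key r hr f ?_
    simp only [Rule.fields, Rule.swap, List.mem_cons, List.not_mem_nil, or_false] at hf ⊢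
    tauto

theorem swap_mem_ruleList {c : Code} {r : Rule FieldName} (hr : r ∈ ruleList c) :
    r.swap ∈ ruleList c := by
  rw [ruleList, List.mem_append, List.mem_map] at hr ⊢
  rcases hr with hr | ⟨r, hr, rfl⟩
  · exact Or.inr ⟨r, hr, rfl⟩
  · exact Or.inl hr

/-- The number of fields. -/
def size (c : Code) : ℕ := (fieldList c).length

/-- The natural number that names a field. -/
noncomputable def idx (c : Code) (f : FieldName) : ℕ := (fieldList c).idxOf f

theorem idx_lt {c : Code} {f : FieldName} (hf : f ∈ fieldList c) : idx c f < size c :=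
  List.idxOf_lt_length_iff.2 hf

/-- The name of an undefined element. -/
def badName (c : Code) : ℕ := size c

/-- The name of the empty list. -/
def nilName (c : Code) : ℕ := size c + 1

/-- The name of the list `[m]`. -/
def numName (c : Code) (m : ℕ) : ℕ := size c + 2 + m

noncomputable def ruleInput (c : Code) (r : Rule FieldName) : Fact (sig (size c)) ℕ :=
  ruleFact (idx c r.p₁) (idx c r.p₂) (numName c r.pos.toNat) (idx c r.l₁) (idx c r.l₂)
    (idx c r.r₁) (idx c r.r₂)

noncomputable def appInput (c : Code) (f : FieldName) (x y : ℕ) : Fact (sig (size c)) ℕ :=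
  appFact (idx c f) x y

noncomputable def fixedInput (c : Code) : List (Fact (sig (size c)) ℕ) :=
  (ruleList c).map (ruleInput c) ++
  [objFact (numName c 0) (fun i => i),
   appInput c ident (numName c 0) (numName c 0),
   appInput c zero (numName c 0) (numName c 0),
   appInput c head (numName c 0) (numName c 0),
   appInput c tail (numName c 0) (nilName c),
   appInput c defd (numName c 0) (numName c 0),
   appInput c head (nilName c) (numName c 0),
   appInput c tail (nilName c) (nilName c),
   appInput c defd (badName c) (badName c)]

/-- The facts that state that the evaluation of `c` on `[n]` is undefined. -/
noncomputable def input (c : Code) (n : ℕ) : List (Fact (sig (size c)) ℕ) :=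
  appInput c (run c) (numName c n) (badName c) ::
  (fixedInput c ++
    (List.range (n + 1)).map fun i => appInput c succ (numName c i) (numName c (i + 1)))

/-- With `c` fixed, the noncomputable field indices are constants; only the number names vary with
`n`. -/
theorem primrec_input (c : Code) : Primrec (input c) := by
  have hnum : Primrec (numName c) := Primrec.nat_add.comp (Primrec.const _) Primrec.id
  have happ {α : Type} [Primcodable α] (f : FieldName) {x y : α → ℕ} (hx : Primrec x)
      (hy : Primrec y) : Primrec fun a => appInput c f (x a) (y a) := by
    refine Primrec.subtype_mk (hp := primrecPred_isFact _) ?_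
    exact Primrec.pair (Primrec.const _) (Primrec.list_cons.comp (Primrec.const _)
      (Primrec.list_cons.comp hx (Primrec.list_cons.comp hy (Primrec.const _))))
  have hsucc : Primrec₂ fun _ i : ℕ => appInput c succ (numName c i) (numName c (i + 1)) :=
    happ succ (hnum.comp Primrec.snd) (hnum.comp (Primrec.succ.comp Primrec.snd))
  exact Primrec.list_cons.comp (happ _ hnum (Primrec.const _))
    (Primrec.list_append.comp (Primrec.const _)
      (Primrec.list_map (Primrec.list_range.comp Primrec.succ) hsucc))

/-! ### Defined evaluations entail the query -/

/-- A model of the input and the constraints in which the query fails. -/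
structure IsCountermodel (c : Code) (n : ℕ) {D : Type} (e : ℕ ↪ D)
    (F : Set (Fact (sig (size c)) D)) : Prop where
  input_mem : ∀ f ∈ input c n, f.map e ∈ F
  sat : ∀ τ ∈ constraints (size c), τ.Sat F
  linear : ∀ i, IsLinear F i
  not_query : ¬ (query (size c)).Sat F

/-- The fact `f(x) = y`. -/
def HasValue (c : Code) {D : Type} (e : ℕ ↪ D) (F : Set (Fact (sig (size c)) D)) (f : FieldName)
    (x y : D) : Prop := appFact (e (idx c f)) x y ∈ F

/-- Objects on which all fields are functions, with values of the same kind. -/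
structure IsObject (c : Code) {D : Type} (e : ℕ ↪ D) (F : Set (Fact (sig (size c)) D)) (x : D) :
    Prop where
  obj : objFact x (fun i : Fin (size c) => e i) ∈ F
  ident : HasValue c e F ident x x
  zero : HasValue c e F zero x (e (numName c 0))

namespace IsCountermodel

variable {c : Code} {n : ℕ} {D : Type} {e : ℕ ↪ D} {F : Set (Fact (sig (size c)) D)}

theorem fixedInput_mem (H : IsCountermodel c n e F)
    {f : Fact (sig (size c)) ℕ} (hf : f ∈ fixedInput c) : f.map e ∈ F :=
  H.input_mem f (by simp [input, hf])

theorem exists_hasValue (H : IsCountermodel c n e F)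
    {x : D} (hx : objFact x (fun i : Fin (size c) => e i) ∈ F)
    {f : FieldName} (hf : f ∈ fieldList c) :
    ∃ y, objFact y (fun i : Fin (size c) => e i) ∈ F ∧ HasValue c e F f x y := by
  obtain ⟨y, hy⟩ := exists_values H.sat hx
  exact ⟨y ⟨idx c f, idx_lt hf⟩, hy ⟨idx c f, idx_lt hf⟩⟩

/-- If the sides differed, the order would compare them one way or the other, and the rule or its
swap would satisfy the query. -/
theorem rule_eq (H : IsCountermodel c n e F)
    {r : Rule FieldName} (hr : r ∈ ruleList c) {x u a y b z : D}
    (h₁ : HasValue c e F r.p₁ x u) (h₂ : HasValue c e F r.p₂ u (e (numName c r.pos.toNat)))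
    (h₃ : HasValue c e F r.l₁ x a) (h₄ : HasValue c e F r.l₂ a y)
    (h₅ : HasValue c e F r.r₁ x b) (h₆ : HasValue c e F r.r₂ b z) : y = z := by
  have key (r : Rule FieldName) (hr : r ∈ ruleList c) : (ruleInput c r).map e ∈ F :=
    H.fixedInput_mem (List.mem_append_left _ (List.mem_map_of_mem hr))
  by_contra hne
  rcases lt_or_lt_of_ne H.linear h₄ h₆ hne with h | h
  · exact H.not_query (query_sat_of_lt (key r hr) h₁ h₂ h₃ h₄ h₅ h₆ h)
  · exact H.not_query (query_sat_of_lt (key r.swap (swap_mem_ruleList hr)) h₁ h₂ h₅ h₆ h₃ h₄ h)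

theorem always_eq (H : IsCountermodel c n e F)
    {l₁ l₂ r₁ r₂ : FieldName} (hr : always l₁ l₂ r₁ r₂ ∈ ruleList c) {x a y b z : D}
    (hx : IsObject c e F x) (h₃ : HasValue c e F l₁ x a) (h₄ : HasValue c e F l₂ a y)
    (h₅ : HasValue c e F r₁ x b) (h₆ : HasValue c e F r₂ b z) : y = z :=
  H.rule_eq hr hx.ident hx.zero h₃ h₄ h₅ h₆

theorem exists_unique_value (H : IsCountermodel c n e F)
    {x : D} (hx : IsObject c e F x) {f : FieldName}
    (hf : f ∈ fieldList c) :
    ∃ y, IsObject c e F y ∧ HasValue c e F f x y ∧ ∀ z, HasValue c e F f x z → z = y := by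
  have hi : always f .ident .ident f ∈ ruleList c :=
    List.mem_append_left _ (List.mem_append_right _ (List.mem_flatMap.2 ⟨f, hf, by simp⟩))
  have hz : always f .zero .ident .zero ∈ ruleList c :=
    List.mem_append_left _ (List.mem_append_right _ (List.mem_flatMap.2 ⟨f, hf, by simp⟩))
  obtain ⟨y, hyo, hy⟩ := H.exists_hasValue hx.obj hf
  obtain ⟨y', -, hy'⟩ := H.exists_hasValue hyo (f := .ident) (by simp [fieldList])
  obtain ⟨y'', -, hy''⟩ := H.exists_hasValue hyo (f := .zero) (by simp [fieldList])
  -- The rule `ident (f x) = f (ident x)` compares one fixed element `y'` with every `f`-value of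
  -- `x`. Hence all values coincide, and `ident` fixes this value, which is thereby an object again.
  have h₁ (z : D) (h : HasValue c e F f x z) : y' = z := H.always_eq hi hx hy hy' hx.ident h
  have h₂ : y'' = e (numName c 0) := H.always_eq hz hx hy hy'' hx.ident hx.zero
  obtain rfl := h₁ y hy
  subst h₂
  exact ⟨y', ⟨hyo, hy', hy''⟩, hy, fun z h => (h₁ z h).symm⟩

theorem isObject_zero (H : IsCountermodel c n e F) : IsObject c e F (e (numName c 0)) where
  obj := by
    have := H.fixedInput_mem (f := objFact (numName c 0) (fun i => i)) (by simp [fixedInput])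
    rwa [objFact_map] at this
  ident := H.fixedInput_mem (f := appInput c .ident (numName c 0) (numName c 0))
    (by simp [fixedInput])
  zero := H.fixedInput_mem (f := appInput c .zero (numName c 0) (numName c 0))
    (by simp [fixedInput])

theorem exists_ap (H : IsCountermodel c n e F) (f : FieldName) (x : {x // IsObject c e F x}) :
    ∃ y : {y // IsObject c e F y}, f ∈ fieldList c →
      HasValue c e F f x y ∧ ∀ z, HasValue c e F f x z → z = y := by
  by_cases hf : f ∈ fieldList c
  · obtain ⟨y, hy, h⟩ := H.exists_unique_value x.2 hf
    exact ⟨⟨y, hy⟩, fun _ => h⟩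
  -- A junk value for unnamed fields makes the chosen functions total.
  · exact ⟨x, fun h => absurd h hf⟩

theorem not_dom (H : IsCountermodel c n e F) : ¬ (c.eval [n]).Dom := by
  intro hdom
  choose ap hap using H.exists_ap
  have hval {f : FieldName} (hf : f ∈ fieldList c) (x : {x // IsObject c e F x}) :
      HasValue c e F f x (ap f x) := (hap f x hf).1
  have huniq {f : FieldName} (hf : f ∈ fieldList c) {x y : {x // IsObject c e F x}}
      (h : HasValue c e F f x y) : ap f x = y := Subtype.ext ((hap f x hf).2 _ h).symm
  have hin {f : FieldName} {x y : ℕ} (h : appInput c f x y ∈ input c n) :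
      HasValue c e F f (e x) (e y) := H.input_mem _ h
  have hident : ident ∈ fieldList c := by simp [fieldList]
  have hzero : zero ∈ fieldList c := by simp [fieldList]
  have hhead : head ∈ fieldList c := by simp [fieldList]
  have htail : tail ∈ fieldList c := by simp [fieldList]
  have hdefd : defd ∈ fieldList c := by simp [fieldList]
  have hsucc : succ ∈ fieldList c := by simp [fieldList]
  have hrun : run c ∈ fieldList c := by simp [fieldList]
  let O : {x // IsObject c e F x} := ⟨e (numName c 0), H.isObject_zero⟩
  -- The input has no object fact for the empty list; it becomes an object as the unique tail of
  -- `[0]`.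
  have hnil : (ap tail O : D) = e (nilName c) :=
    ((hap tail O htail).2 _ (hin (by simp [input, fixedInput]))).symm
  let B : Basis {x // IsObject c e F x} ap :=
    { zeroC := O
      nilC := ap tail O
      ident_ap := fun x => huniq hident x.2.ident
      zero_ap := fun x => huniq hzero x.2.zero
      head_zero := huniq hhead (hin (by simp [input, fixedInput]))
      tail_zero := rfl
      defd_zero := huniq hdefd (hin (by simp [input, fixedInput]))
      head_nil := huniq hhead (by rw [hnil]; exact hin (by simp [input, fixedInput]))
      tail_nil := huniq htail (by rw [hnil]; exact hin (by simp [input, fixedInput])) }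
  -- The bound `n + 1` rather than `n` covers the guard constant `[1]` even when `n = 0`.
  have hnum (m : ℕ) (hm : m ≤ n + 1) : (B.num m : D) = e (numName c m) := by
    induction m with
    | zero => rfl
    | succ m ih =>
      rw [B.num_succ]
      refine ((hap succ _ hsucc).2 _ ?_).symm
      rw [ih (by omega)]
      refine hin (List.mem_cons_of_mem _ (List.mem_append_right _ (List.mem_map.2 ⟨m, ?_, rfl⟩)))
      exact List.mem_range.2 (by omega)
  have hvalid (r : Rule FieldName) (hr : r ∈ ruleList c) : r.Valid ap B.const := by
    have hm {f : FieldName} (hf : f ∈ r.fields) := mem_fieldList hr hf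
    intro x hx
    refine Subtype.ext (H.rule_eq hr (hval (hm (by simp [Rule.fields])) x) ?_
      (hval (hm (by simp [Rule.fields])) x) (hval (hm (by simp [Rule.fields])) _)
      (hval (hm (by simp [Rule.fields])) x) (hval (hm (by simp [Rule.fields])) _))
    rw [← hnum _ (by cases r.pos <;> simp)]
    change HasValue c e F r.p₂ _ (B.const r.pos)
    rw [← hx]
    exact hval (hm (by simp [Rule.fields])) _
  have hdata : ∀ r ∈ dataRules, r.Valid ap B.const := fun r hr =>
    hvalid r (by simp [ruleList, equations, hr])
  have hcode : ∀ r ∈ codeRules c, r.Valid ap B.const := fun r hr =>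
    hvalid r (by simp [ruleList, equations, hr])
  have hrep := Basis.Rep.run hdata c hcode [n] _ (Part.get_mem hdom) _ (Basis.rep_num hdata n)
  have hbad : (ap (run c) (B.num n) : D) = e (badName c) := by
    refine ((hap (run c) _ hrun).2 _ ?_).symm
    rw [hnum n (by omega)]
    exact hin (by simp [input])
  have hbad' : (ap defd (ap (run c) (B.num n)) : D) = e (badName c) := by
    refine ((hap defd _ hdefd).2 _ ?_).symm
    rw [hbad]
    exact hin (by simp [input, fixedInput])
  -- The result is represented, so `defd` sends it to zero; but it is the bad element, which `defd`
  -- fixes.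
  rw [hrep.1] at hbad'
  have := e.injective hbad'
  simp [numName, badName] at this

end IsCountermodel

/-! ### Undefined evaluations have countermodels -/

/-- The names of the fields, and the partial lists. -/
abbrev Dom : Type := ℕ ⊕ Part (List ℕ)

/-- The interpretation of the field with the given name. -/
noncomputable def semIdx (c : Code) (i : ℕ) : Part (List ℕ) → Part (List ℕ) :=
  sem ((fieldList c).getD i ident)

theorem semIdx_idx {c : Code} {f : FieldName} (hf : f ∈ fieldList c) :
    semIdx c (idx c f) = sem f := by
  rw [semIdx, List.getD_eq_getElem _ _ (idx_lt hf)]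
  exact congrArg sem (List.getElem_idxOf (idx_lt hf))

/-- The elements with the given names. -/
noncomputable def element (c : Code) (j : ℕ) : Dom :=
  if j < size c then Sum.inl j
  else if j = badName c then Sum.inr Part.none
  else if j = nilName c then Sum.inr (Part.some [])
  else Sum.inr (Part.some [j - size c - 2])

theorem element_lt {c : Code} {j : ℕ} (h : j < size c) : element c j = Sum.inl j := if_pos h

theorem element_bad (c : Code) : element c (badName c) = Sum.inr Part.none := by
  simp [element, badName]

theorem element_nil (c : Code) : element c (nilName c) = Sum.inr (Part.some []) := by
  simp [element, nilName, badName]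

theorem element_num (c : Code) (m : ℕ) : element c (numName c m) = Sum.inr (Part.some [m]) := by
  have h₁ : ¬ size c + 2 + m < size c := by omega
  have h₂ : size c + 2 + m ≠ size c := by omega
  have h₃ : size c + 2 + m ≠ size c + 1 := by omega
  have h₄ : size c + 2 + m - size c - 2 = m := by omega
  simp [element, nilName, badName, numName, h₁, h₂, h₃, h₄]

theorem name_cases (c : Code) (j : ℕ) :
    j < size c ∨ j = badName c ∨ j = nilName c ∨ ∃ m, j = numName c m := by
  simp only [badName, nilName, numName]
  by_cases h : size c + 2 ≤ j
  · exact Or.inr (Or.inr (Or.inr ⟨j - (size c + 2), by omega⟩))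
  · omega

theorem element_injective (c : Code) : Function.Injective (element c) := by
  intro i j h
  have h₁ (v : List ℕ) : Part.none ≠ Part.some v := (Part.some_ne_none v).symm
  rcases name_cases c i with hi | rfl | rfl | ⟨m, rfl⟩ <;>
    rcases name_cases c j with hj | rfl | rfl | ⟨m', rfl⟩ <;>
    simp_all [element_lt, element_bad, element_nil, element_num]

noncomputable def naming (c : Code) : ℕ ↪ Dom := ⟨element c, element_injective c⟩

theorem naming_lt {c : Code} {j : ℕ} (h : j < size c) : naming c j = Sum.inl j := element_lt h

theorem naming_idx {c : Code} {f : FieldName} (h : f ∈ fieldList c) :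
    naming c (idx c f) = Sum.inl (idx c f) := naming_lt (idx_lt h)

theorem naming_bad (c : Code) : naming c (badName c) = Sum.inr Part.none := element_bad c

theorem naming_nil (c : Code) : naming c (nilName c) = Sum.inr (Part.some []) := element_nil c

theorem naming_num (c : Code) (m : ℕ) : naming c (numName c m) = Sum.inr (Part.some [m]) :=
  element_num c m

/-- The standard model, with a well-order of its elements. -/
inductive StdFact (c : Code) : Fact (sig (size c)) Dom → Prop
  | obj (x : Part (List ℕ)) : StdFact c (objFact (Sum.inr x) fun i => Sum.inl i)
  | record (x : Part (List ℕ)) :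
      StdFact c (recFact (Sum.inr x) (fun i => Sum.inr (semIdx c i x)) fun i => Sum.inl i)
  | app (i : ℕ) (x : Part (List ℕ)) :
      StdFact c (appFact (Sum.inl i) (Sum.inr x) (Sum.inr (semIdx c i x)))
  | rule (r : Rule FieldName) (hr : r ∈ ruleList c) :
      StdFact c (ruleFact (Sum.inl (idx c r.p₁)) (Sum.inl (idx c r.p₂)) (Sum.inr (semConst r.pos))
        (Sum.inl (idx c r.l₁)) (Sum.inl (idx c r.l₂)) (Sum.inl (idx c r.r₁))
        (Sum.inl (idx c r.r₂)))
  | lt (x y : Dom) (h : WellOrderingRel x y) : StdFact c (ltFact x y)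

/-- The number of the relation of a fact. -/
def relNumber {k : ℕ} {D : Type} (f : Fact (sig k) D) : ℕ :=
  Sum.elim (fun i : Fin 4 => (i : ℕ)) (fun _ : Fin 1 => 4) f.1.1

/-! ### Inversion of the facts of the standard model -/

section Parts

variable {k : ℕ} {D : Type} (x y z p₁ p₂ v l₁ l₂ r₁ r₂ : D) (m n : Fin k → D)

theorem relNumber_objFact : relNumber (objFact x n) = 0 := rfl

theorem relNumber_recFact : relNumber (recFact x m n) = 1 := rfl

theorem relNumber_appFact : relNumber (appFact x y z : Fact (sig k) D) = 2 := rfl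

theorem relNumber_ruleFact :
    relNumber (ruleFact p₁ p₂ v l₁ l₂ r₁ r₂ : Fact (sig k) D) = 3 := rfl

theorem relNumber_ltFact : relNumber (ltFact x y : Fact (sig k) D) = 4 := rfl

theorem args_objFact : (objFact x n).args = x :: List.ofFn n := rfl

theorem args_appFact : (appFact x y z : Fact (sig k) D).args = [x, y, z] := rfl

theorem args_ruleFact : (ruleFact p₁ p₂ v l₁ l₂ r₁ r₂ : Fact (sig k) D).args =
    [p₁, p₂, v, l₁, l₂, r₁, r₂] := rfl

theorem args_ltFact : (ltFact x y : Fact (sig k) D).args = [x, y] := rfl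

end Parts

namespace StdFact

variable {c : Code}

theorem obj_inv {x : Dom} {n : Fin (size c) → Dom} (h : StdFact c (objFact x n)) :
    (∃ x', x = Sum.inr x') ∧ n = fun i : Fin (size c) => Sum.inl (i : ℕ) := by
  -- The index of `StdFact` is not in constructor form, so it is replaced by an equation; relation
  -- numbers then exclude the wrong cases.
  generalize hf : (objFact x n : Fact (sig (size c)) Dom) = f at h
  have hr := congrArg relNumber hf
  have ha := congrArg Fact.args hf
  cases h <;> simp [relNumber_objFact, relNumber_recFact, relNumber_appFact,
    relNumber_ruleFact, relNumber_ltFact] at hr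
  obtain ⟨rfl, h⟩ := List.cons.inj ha
  exact ⟨⟨_, rfl⟩, List.ofFn_injective h⟩

theorem rec_inv {x : Dom} {y n : Fin (size c) → Dom} (h : StdFact c (recFact x y n)) :
    ∃ x', x = Sum.inr x' ∧ y = (fun i : Fin (size c) => Sum.inr (semIdx c i x')) ∧
      n = fun i : Fin (size c) => Sum.inl (i : ℕ) := by
  generalize hf : (recFact x y n : Fact (sig (size c)) Dom) = f at h
  have hr := congrArg relNumber hf
  have ha := congrArg Fact.args hf
  cases h <;> simp [relNumber_objFact, relNumber_recFact, relNumber_appFact,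
    relNumber_ruleFact, relNumber_ltFact] at hr
  obtain ⟨rfl, h⟩ := List.cons.inj ha
  obtain ⟨h₁, h₂⟩ := List.append_inj h (by simp)
  exact ⟨_, rfl, List.ofFn_injective h₁, List.ofFn_injective h₂⟩

theorem app_inv {f x y : Dom} (h : StdFact c (appFact f x y)) :
    ∃ i x', f = Sum.inl i ∧ x = Sum.inr x' ∧ y = Sum.inr (semIdx c i x') := by
  generalize hf : (appFact f x y : Fact (sig (size c)) Dom) = f at h
  have hr := congrArg relNumber hf
  have ha := congrArg Fact.args hf
  cases h <;> simp [relNumber_objFact, relNumber_recFact, relNumber_appFact,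
    relNumber_ruleFact, relNumber_ltFact] at hr
  simp only [args_appFact, List.cons.injEq, and_true] at ha
  exact ⟨_, _, ha⟩

theorem rule_inv {p₁ p₂ v l₁ l₂ r₁ r₂ : Dom} (h : StdFact c (ruleFact p₁ p₂ v l₁ l₂ r₁ r₂)) :
    ∃ r ∈ ruleList c, p₁ = Sum.inl (idx c r.p₁) ∧ p₂ = Sum.inl (idx c r.p₂) ∧
      v = Sum.inr (semConst r.pos) ∧ l₁ = Sum.inl (idx c r.l₁) ∧ l₂ = Sum.inl (idx c r.l₂) ∧
      r₁ = Sum.inl (idx c r.r₁) ∧ r₂ = Sum.inl (idx c r.r₂) := by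
  generalize hf : (ruleFact p₁ p₂ v l₁ l₂ r₁ r₂ : Fact (sig (size c)) Dom) = f at h
  have hr := congrArg relNumber hf
  have ha := congrArg Fact.args hf
  cases h <;> simp [relNumber_objFact, relNumber_recFact, relNumber_appFact,
    relNumber_ruleFact, relNumber_ltFact] at hr
  simp only [args_ruleFact, List.cons.injEq, and_true] at ha
  exact ⟨_, ‹_›, ha⟩

theorem lt_inv {x y : Dom} (h : StdFact c (ltFact x y)) : WellOrderingRel x y := by
  generalize hf : (ltFact x y : Fact (sig (size c)) Dom) = f at h
  have hr := congrArg relNumber hf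
  have ha := congrArg Fact.args hf
  cases h <;> simp [relNumber_objFact, relNumber_recFact, relNumber_appFact,
    relNumber_ruleFact, relNumber_ltFact] at hr
  simp only [args_ltFact, List.cons.injEq, and_true] at ha
  obtain ⟨rfl, rfl⟩ := ha
  assumption

theorem app_idx_inv {f : FieldName} (hf : f ∈ fieldList c) {x : Part (List ℕ)} {y : Dom}
    (h : StdFact c (appFact (Sum.inl (idx c f)) (Sum.inr x) y)) : y = Sum.inr (sem f x) := by
  obtain ⟨i, x', hi, hx, hy⟩ := h.app_inv
  cases hi
  cases hx
  rw [hy, semIdx_idx hf]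

theorem isLinear (i : Fin 1) : IsLinear (σ := sig (size c)) {f | StdFact c f} i := by
  obtain rfl : i = 0 := Subsingleton.elim _ _
  refine ⟨fun a _ h => ?_, fun a _ b _ d _ h₁ h₂ => ?_, fun a _ b _ hne => ?_⟩
  · exact irrefl_of WellOrderingRel a (lt_inv h)
  · exact StdFact.lt _ _ (_root_.trans (lt_inv h₁) (lt_inv h₂))
  · rcases trichotomous_of WellOrderingRel a b with h | h | h
    · exact Or.inl (StdFact.lt _ _ h)
    · exact absurd h hne
    · exact Or.inr (StdFact.lt _ _ h)

theorem sat : ∀ τ ∈ constraints (size c), τ.Sat {f | StdFact c f} := by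
  intro τ hτ h hb
  simp only [constraints, List.mem_cons, List.mem_flatMap, List.mem_finRange, true_and,
    List.not_mem_nil, or_false] at hτ
  rcases hτ with rfl | ⟨i, rfl | rfl⟩
  · have hb : StdFact c (objFact (h 0) (h ∘ nameVar _)) := by simpa [recTGD, Holds] using hb
    obtain ⟨⟨x, hx⟩, hn⟩ := hb.obj_inv
    refine ⟨assign (h 0) (fun i : Fin (size c) => Sum.inr (semIdx c i x)) (h ∘ nameVar _), ?_, ?_⟩
    · intro j hj
      obtain ⟨A, hA, hj⟩ := hj
      obtain rfl := List.mem_singleton.1 hA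
      rw [args_objFact, List.mem_cons, List.mem_ofFn] at hj
      rcases hj with rfl | ⟨i, rfl⟩
      · exact assign_zero _ _ _
      · exact congrFun (assign_name (h 0) _ _) i
    · simp only [Holds, recTGD, List.mem_singleton, forall_eq, recFact_map, assign_zero,
        assign_val, assign_name, hx, hn]
      exact StdFact.record x
  · have hb : StdFact c (recFact (h 0) (h ∘ valVar _) (h ∘ nameVar _)) := by
      simpa [objTGD, Holds] using hb
    obtain ⟨x, hx, hy, hn⟩ := hb.rec_inv
    refine ⟨h, fun _ _ => rfl, ?_⟩
    have hy' : h (valVar _ i) = Sum.inr (semIdx c i x) := congrFun hy i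
    simp only [Holds, objTGD, List.mem_singleton, forall_eq, objFact_map, hy', hn]
    exact StdFact.obj _
  · have hb : StdFact c (recFact (h 0) (h ∘ valVar _) (h ∘ nameVar _)) := by
      simpa [appTGD, Holds] using hb
    obtain ⟨x, hx, hy, hn⟩ := hb.rec_inv
    refine ⟨h, fun _ _ => rfl, ?_⟩
    have hy' : h (valVar _ i) = Sum.inr (semIdx c i x) := congrFun hy i
    have hn' : h (nameVar _ i) = Sum.inl (i : ℕ) := congrFun hn i
    simp only [Holds, appTGD, List.mem_singleton, forall_eq, appFact_map, hy', hn', hx]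
    exact StdFact.app _ _

end StdFact

theorem valid_ruleList (c : Code) : ∀ r ∈ ruleList c, r.Valid sem semConst := by
  have key : ∀ r ∈ equations c, r.Valid sem semConst := by
    intro r hr
    simp only [equations, List.mem_append, List.mem_flatMap, List.mem_cons, List.not_mem_nil,
      or_false] at hr
    rcases hr with (hr | hr) | ⟨f, -, rfl | rfl⟩
    · exact valid_dataRules r hr
    · exact valid_codeRules c r hr
    · exact fun _ _ => rfl
    · exact fun _ _ => rfl
  intro r hr
  rw [ruleList, List.mem_append, List.mem_map] at hr
  rcases hr with hr | ⟨r, hr, rfl⟩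
  · exact key r hr
  · exact (key r hr).swap

/-- A match would evaluate both sides of a valid equation under its guard, so an element would be
less than itself. -/
theorem not_query_sat_std (c : Code) : ¬ (query (size c)).Sat {f | StdFact c f} := by
  rintro ⟨h, hh⟩
  simp only [Holds, query, List.forall_mem_cons, ruleFact_map, appFact_map, ltFact_map,
    Set.mem_ofPred_eq] at hh
  obtain ⟨hr, h₁, h₂, h₃, h₄, h₅, h₆, hlt, -⟩ := hh
  obtain ⟨r, hr, e₀, e₁, e₂, e₃, e₄, e₅, e₆⟩ := hr.rule_inv
  have hm {f : FieldName} (hf : f ∈ r.fields) := mem_fieldList hr hf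
  obtain ⟨_, x, -, hx, -⟩ := h₁.app_inv
  rw [e₀, hx] at h₁
  have hu := h₁.app_idx_inv (hm (by simp [Rule.fields]))
  rw [e₁, hu] at h₂
  have hv := h₂.app_idx_inv (hm (by simp [Rule.fields]))
  rw [e₃, hx] at h₃
  have ha := h₃.app_idx_inv (hm (by simp [Rule.fields]))
  rw [e₄, ha] at h₄
  have hy := h₄.app_idx_inv (hm (by simp [Rule.fields]))
  rw [e₅, hx] at h₅
  have hb := h₅.app_idx_inv (hm (by simp [Rule.fields]))
  rw [e₆, hb] at h₆
  have hz := h₆.app_idx_inv (hm (by simp [Rule.fields]))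
  have heq := valid_ruleList c r hr x (Sum.inr_injective (hv.symm.trans e₂))
  have hlt := hlt.lt_inv
  rw [hy, hz, heq] at hlt
  exact irrefl_of WellOrderingRel _ hlt

theorem stdFact_appInput {c : Code} {f : FieldName} (hf : f ∈ fieldList c) {a b : ℕ}
    {x y : Part (List ℕ)} (ha : naming c a = Sum.inr x) (hb : naming c b = Sum.inr y)
    (h : sem f x = y) : StdFact c ((appInput c f a b).map (naming c)) := by
  rw [appInput, appFact_map, naming_idx hf, ha, hb, ← h, ← semIdx_idx hf]
  exact StdFact.app _ _

theorem stdFact_input {c : Code} {n : ℕ} (h : ¬ (c.eval [n]).Dom) :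
    ∀ f ∈ input c n, StdFact c (f.map (naming c)) := by
  simp only [input, fixedInput, List.forall_mem_cons, List.forall_mem_append, List.forall_mem_map]
  have hO := naming_num c 0
  have hN := naming_nil c
  have hB := naming_bad c
  refine ⟨?_, ⟨?_, ?_, ?_, ?_, ?_, ?_, ?_, ?_, ?_, ?_, by simp⟩, ?_⟩
  · refine stdFact_appInput (by simp [fieldList]) (naming_num c n) hB ?_
    simpa [sem, evalPart] using Part.eq_none_iff'.2 h
  · intro r hr
    have hm {f : FieldName} (hf : f ∈ r.fields) := naming_idx (mem_fieldList hr hf)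
    rw [ruleInput, ruleFact_map, naming_num, hm (by simp [Rule.fields]),
      hm (by simp [Rule.fields]), hm (by simp [Rule.fields]), hm (by simp [Rule.fields]),
      hm (by simp [Rule.fields]), hm (by simp [Rule.fields])]
    exact StdFact.rule r hr
  · rw [objFact_map, hO]
    convert StdFact.obj (c := c) (Part.some [0]) using 2
    funext i
    exact naming_lt i.2
  · exact stdFact_appInput (by simp [fieldList]) hO hO (by simp [sem])
  · exact stdFact_appInput (by simp [fieldList]) hO hO (by simp [sem])
  · exact stdFact_appInput (by simp [fieldList]) hO hO (by simp [sem])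
  · exact stdFact_appInput (by simp [fieldList]) hO hN (by simp [sem])
  · exact stdFact_appInput (by simp [fieldList]) hO hO (by simp [sem])
  · exact stdFact_appInput (by simp [fieldList]) hN hO (by simp [sem])
  · exact stdFact_appInput (by simp [fieldList]) hN hN (by simp [sem])
  · exact stdFact_appInput (by simp [fieldList]) hB hB (by simp [sem])
  · intro i _
    exact stdFact_appInput (by simp [fieldList]) (naming_num c i) (naming_num c (i + 1))
      (by simp [sem])

/-! ### The reductions -/

theorem entailsLin_input_iff (c : Code) (n : ℕ) :
    EntailsLin (input c n) (constraints (size c)) (query (size c)).toUCQ ↔ (c.eval [n]).Dom := by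
  constructor
  · intro h
    by_contra hn
    obtain ⟨q, hq, hs⟩ := h Dom (naming c) {f | StdFact c f} (stdFact_input hn) StdFact.sat
      StdFact.isLinear
    obtain rfl := List.mem_singleton.1 hq
    exact not_query_sat_std c hs
  · intro h D e F h₁ h₂ h₃
    refine ⟨_, List.mem_singleton_self _, ?_⟩
    by_contra hq
    exact IsCountermodel.not_dom ⟨h₁, h₂, h₃, hq⟩ h

theorem IsLinear.irrefl {k : ℕ} {D : Type} {F : Set (Fact (sig k) D)}
    (h : ∀ i, IsLinear F i) (x : D) : ltFact x x ∉ F := fun hx =>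
  (h (0 : Fin 1)).1 x ⟨_, hx, by simp [Fact.args, ltFact, distFact]⟩ hx

/-- The constraint that a query is false: it implies that an element is less than itself. -/
def denial {k : ℕ} (Q : CQ (sig k)) : TGD (sig k) := ⟨Q.atoms, [ltFact 0 0]⟩

theorem denial_isBaseFGTGD {k : ℕ} (Q : CQ (sig k)) : (denial Q).IsBaseFGTGD :=
  Or.inr ⟨0, fun x hx => by
    simpa [TGD.frontier, denial, varsOf, Fact.args, ltFact, distFact] using hx.2⟩

theorem TGD.IsID.isBaseFGTGD {σ : Signature} {τ : TGD σ} (h : τ.IsID) (hb : τ.OnBase) :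
    τ.IsBaseFGTGD := by
  obtain ⟨A, -, hA, -⟩ := h
  have hm : A ∈ τ.body := by simp [hA]
  refine Or.inl ⟨A, hm, hb.1 A hm, ?_⟩
  rintro x ⟨⟨A', hA', hx⟩, -⟩
  rw [hA, List.mem_singleton] at hA'
  rwa [← hA']

/-- By irreflexivity, the linear models of `denial Q` are exactly those refuting `Q`. -/
theorem entailsLin_denial_iff {k : ℕ} (F₀ : List (Fact (sig k) ℕ)) (S : List (TGD (sig k)))
    (Q : CQ (sig k)) :
    EntailsLin F₀ (denial Q :: S) (UCQ.bot (sig k)) ↔ EntailsLin F₀ S Q.toUCQ := by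
  constructor
  · intro h D e F h₁ h₂ h₃
    refine ⟨Q, List.mem_singleton_self _, ?_⟩
    by_contra hq
    obtain ⟨q, hq', -⟩ := h D e F h₁
      (List.forall_mem_cons.2 ⟨fun g hg => absurd ⟨g, hg⟩ hq, h₂⟩) h₃
    simp [UCQ.bot] at hq'
  · intro h D e F h₁ h₂ h₃
    obtain ⟨hd, h₂⟩ := List.forall_mem_cons.1 h₂
    obtain ⟨q, hq, g, hg⟩ := h D e F h₁ h₂ h₃
    obtain rfl := List.mem_singleton.1 hq
    obtain ⟨g', -, hg'⟩ := hd g hg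
    exact absurd (hg' _ (List.mem_singleton_self _)) (IsLinear.irrefl h₃ (g' 0))

theorem exists_code_undecidable :
    ∃ c : Code, ¬ ComputablePred fun n : ℕ => (c.eval [n]).Dom := by
  -- A universal function: a code for it halts on `[m]` exactly when the `m`-th program halts on 0.
  let f : ℕ →. ℕ := fun m => Nat.Partrec.Code.eval (Denumerable.ofNat _ m) 0
  have hf : Partrec f :=
    Nat.Partrec.Code.eval_part.comp (Computable.ofNat _) (Computable.const 0)
  obtain ⟨c, hc⟩ := Turing.ToPartrec.Code.exists_code (Nat.Partrec'.part_iff₁.2 hf)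
  refine ⟨c, fun h => ComputablePred.halting_problem 0 ?_⟩
  have h' : ComputablePred fun a : Nat.Partrec.Code => (c.eval [Encodable.encode a]).Dom := by
    obtain ⟨_, h⟩ := h
    exact ⟨fun _ => inferInstance, h.comp Computable.encode⟩
  refine h'.of_eq fun a => ?_
  have := hc ⟨[Encodable.encode a], rfl⟩
  rw [this]
  simp [f, List.Vector.head]

end QALin

theorem mainTheorem12 :
    (∃ σ : QALin.Signature, σ.numDist = 1 ∧
      ∃ (S : List (QALin.TGD σ)) (Q : QALin.CQ σ),
        (∀ τ ∈ S, τ.IsID ∧ τ.OnBase) ∧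
        ¬ Q.BaseCovered ∧
        ¬ ComputablePred fun F₀ : List (QALin.Fact σ ℕ) =>
          QALin.EntailsLin F₀ S Q.toUCQ) ∧
    (∃ σ : QALin.Signature, σ.numDist = 1 ∧
      ∃ S : List (QALin.TGD σ),
        (∀ τ ∈ S, τ.IsBaseFGTGD) ∧
        ¬ ComputablePred fun F₀ : List (QALin.Fact σ ℕ) =>
          QALin.EntailsLin F₀ S (QALin.UCQ.bot σ)) := by
  obtain ⟨c, hc⟩ := QALin.exists_code_undecidable
  have hred {p : List (QALin.Fact (QALin.sig (QALin.size c)) ℕ) → Prop} (hp : ComputablePred p)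
      (h : ∀ n, p (QALin.input c n) ↔ (c.eval [n]).Dom) : False := by
    obtain ⟨_, hp⟩ := hp
    exact hc (ComputablePred.of_eq
      ⟨fun _ => inferInstance, hp.comp (QALin.primrec_input c).to_comp⟩ h)
  refine ⟨⟨QALin.sig (QALin.size c), rfl, QALin.constraints _, QALin.query _,
      QALin.constraints_spec _, QALin.query_not_baseCovered _,
      fun h => hred h (QALin.entailsLin_input_iff c)⟩,
    ⟨QALin.sig (QALin.size c), rfl, QALin.denial (QALin.query _) :: QALin.constraints _,
      List.forall_mem_cons.2 ⟨QALin.denial_isBaseFGTGD _, fun τ hτ => ?_⟩,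
      fun h => hred h fun n => (QALin.entailsLin_denial_iff _ _ _).trans
        (QALin.entailsLin_input_iff c n)⟩⟩
  obtain ⟨h₁, h₂⟩ := QALin.constraints_spec _ τ hτ
  exact h₁.isBaseFGTGD h₂
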